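/- Let $N\ge 2$ and $R\ge 2$ be fixed integers. For $i\in\{1,\dots,N\}$ let $\mathcal X_i\subset\mathbb R$ be a fixed finite alphabet, and for $r\in\{1,\dots,R\}$ let $P_{\mathcal X_i,r}$ be a probability distribution on $\mathcal X_i$ such that $\max_{i,r}\max_{x\in\mathcal X_i}P_{\mathcal X_i,r}(x)<1$. For each $n$, let $\mathbf X_1,\dots,\mathbf X_N$ be random $n\times R$ matrices, all of whose entries (across all matrices, rows and columns) are independent, the entries of column $r$ of $\mathbf X_i$ having distribution $P_{\mathcal X_i,r}$. Let $\mathbf T=[\mathbf X_1;\dots;\mathbf X_N]\in\mathbb R^{n\times\cdots\times n}$ be the random tensor of order $N$ with entries $$T_{k_1,\dots,k_N}=\sum_{r=1}^R\prod_{i=1}^N (\mathbf X_i)_{k_i r},$$ and let $\mathcal T_n$ be the set of all tensors of this form whose $i$-th factor matrix has entries in $\mathcal X_i$ for every $i$. A compression-reconstruction scheme for size $n$ consists of a finite set $\mathcal M_n$ and maps $\phi_n:\mathcal T_n\to\mathcal M_n$, $\psi_n:\mathcal M_n\to\mathcal T_n$. A real number $C$ is an almost-losslessly achievable threshold if there is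 a sequence of such schemes with $$\limsup_{n\to\infty}\frac1n\log|\mathcal M_n|\le C\qquad\text{and}\qquad \lim_{n\to\infty}\Pr\{\psi_n(\phi_n(\mathbf T))\ne\mathbf T\}=0 .$$ Let $C_t^\star$ be the infimum of all almost-losslessly achievable thresholds. Then $$C_t^\star=\sum_{i=1}^N\sum_{r=1}^R H(P_{\mathcal X_i,r}),\qquad H(P)=-\sum_x P(x)\log P(x),$$ where $\log$ is the natural logarithm and $0\log 0=0$. -/

import Mathlib

open MeasureTheory ProbabilityTheory Filter Topology

namespace TensorCompression

/-- Real tensors of order `N` all of whose dimensions are equal to `n`. -/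
abbrev Tensor (N n : ℕ) : Type := (Fin N → Fin n) → ℝ

/-- The tensor `[A₁; …; A_N]` with factor matrices `A i` of size `n × R`: the sum over `r` of the
outer products of the `r`-th columns of `A₁, …, A_N`. -/
def cpTensor {N R n : ℕ} (A : Fin N → Matrix (Fin n) (Fin R) ℝ) : Tensor N n :=
  fun k => ∑ r, ∏ i, A i (k i) r

/-- The tensor alphabet: all tensors `[A₁; …; A_N]` whose factor matrices `A i`, of size `n × R`,
have entries in the finite alphabet `𝒳 i`. -/
def tensorAlphabet {N : ℕ} (R : ℕ) (𝒳 : Fin N → Finset ℝ) (n : ℕ) : Set (Tensor N n) :=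
  {T | ∃ A : Fin N → Matrix (Fin n) (Fin R) ℝ, (∀ i j r, A i j r ∈ 𝒳 i) ∧ T = cpTensor A}

/-- The random tensor built from random factor matrices; `X i j r` is the `(j, r)` entry of the
`i`-th factor matrix. -/
def randomTensor {N R n : ℕ} {𝒳 : Fin N → Finset ℝ} {Ω : Type*}
    (X : (i : Fin N) → Fin n → Fin R → Ω → 𝒳 i) (ω : Ω) : tensorAlphabet R 𝒳 n :=
  ⟨cpTensor fun i => Matrix.of fun j r => (X i j r ω : ℝ),
    fun i => Matrix.of fun j r => (X i j r ω : ℝ), fun i j r => (X i j r ω).2, rfl⟩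

/-- A compression-reconstruction scheme for objects in `𝒯`: a finite index set `M`, a compression
mapping and a reconstruction mapping. -/
structure CompressionScheme (𝒯 : Type*) where
  /-- the set of indices -/
  M : Type
  /-- the index set is finite -/
  finite_M : Finite M
  /-- the compression mapping -/
  φ : 𝒯 → M
  /-- the reconstruction mapping -/
  ψ : M → 𝒯

/-- The threshold `C` is almost-losslessly achievable for the sequence of random objects `T n`. The
limit superior is taken in the extended reals, so that it is meaningful for unbounded sequences. -/
def AlmostLosslesslyAchievable {Ω : ℕ → Type*} [∀ n, MeasurableSpace (Ω n)]
    (μ : (n : ℕ) → Measure (Ω n)) {𝒯 : ℕ → Type*} (T : (n : ℕ) → Ω n → 𝒯 n) (C : ℝ) : Prop :=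
  ∃ S : (n : ℕ) → CompressionScheme (𝒯 n),
    limsup (fun n : ℕ => ((1 / (n : ℝ) * Real.log (Nat.card (S n).M) : ℝ) : EReal)) atTop
        ≤ (C : EReal) ∧
    Tendsto (fun n => μ n {ω | (S n).ψ ((S n).φ (T n ω)) ≠ T n ω}) atTop (𝓝 0)

/-- The minimum almost-lossless compression threshold: the infimum, in the extended reals, of all
almost-losslessly achievable thresholds. -/
noncomputable def minThreshold {Ω : ℕ → Type*} [∀ n, MeasurableSpace (Ω n)]
    (μ : (n : ℕ) → Measure (Ω n)) {𝒯 : ℕ → Type*} (T : (n : ℕ) → Ω n → 𝒯 n) : EReal :=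
  ⨅ (C : ℝ) (_ : AlmostLosslesslyAchievable μ T C), (C : EReal)

/-- The entropy, in nats, of a distribution on a finite alphabet (with `0 log 0 = 0`). -/
noncomputable def entropy {α : Type*} [Fintype α] (P : PMF α) : ℝ :=
  ∑ x, -((P x).toReal * Real.log (P x).toReal)

end TensorCompression

/-! The factor matrices form a word of `n * N * R` independent letters with total entropy `n * H`,
where `H` is the claimed threshold. By Chebyshev, the information density of this word is `n * H +
o(n)` with high probability. Upper bound: the tensor is a function of the word, so indexing the
typical words suffices. Lower bound: the tensor need not determine the word, since for instance
columns may be permuted. It does determine it on the event that the first `R + 1` rows of every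
factor take prescribed values (`cpTensor_injective_of_rows`). This event has a positive probability
`δ` independent of `n`. A scheme with vanishing error must decode most of this event, which takes
about `δ * exp (n * H)` indices; the factor `δ` costs only `log δ / n`, which tends to `0`. -/

namespace TensorCompression

/-! ### Information density of product laws -/

section ProductLaw

variable {ι : Type*} [Fintype ι] {α : ι → Type*}

/-- The information density (self-information) of `a` under the product of the `P p`. -/
noncomputable def infoDensity (P : ∀ p, PMF (α p)) (a : ∀ p, α p) : ℝ :=
  ∑ p, -Real.log (P p (a p)).toReal

lemma exp_neg_infoDensity (P : ∀ p, PMF (α p)) (a : ∀ p, α p) :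
    Real.exp (-infoDensity P a) = ∏ p, Real.exp (Real.log (P p (a p)).toReal) := by
  rw [← Real.exp_sum, infoDensity, ← Finset.sum_neg_distrib]
  simp

variable [∀ p, MeasurableSpace (α p)] [∀ p, MeasurableSingletonClass (α p)]

lemma pi_real_singleton (P : ∀ p, PMF (α p)) (a : ∀ p, α p) :
    (Measure.pi fun p => (P p).toMeasure).real {a} = ∏ p, (P p (a p)).toReal := by
  rw [measureReal_def, ← Set.univ_pi_singleton, Measure.pi_pi, ENNReal.toReal_prod]
  simp [PMF.toMeasure_apply_singleton]

/-- Only an inequality in general: since `Real.log 0 = 0`, a letter of probability zero contributes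
a factor `1` on the right. The converse needs no more. -/
lemma pi_real_singleton_le (P : ∀ p, PMF (α p)) (a : ∀ p, α p) :
    (Measure.pi fun p => (P p).toMeasure).real {a} ≤ Real.exp (-infoDensity P a) := by
  rw [pi_real_singleton, exp_neg_infoDensity]
  exact Finset.prod_le_prod (fun _ _ => ENNReal.toReal_nonneg) fun _ _ => Real.le_exp_log _

lemma pi_real_singleton_eq (P : ∀ p, PMF (α p)) {a : ∀ p, α p}
    (ha : (Measure.pi fun p => (P p).toMeasure).real {a} ≠ 0) :
    (Measure.pi fun p => (P p).toMeasure).real {a} = Real.exp (-infoDensity P a) := by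
  rw [pi_real_singleton] at ha ⊢
  rw [exp_neg_infoDensity]
  refine Finset.prod_congr rfl fun p hp => (Real.exp_log ?_).symm
  exact lt_of_le_of_ne ENNReal.toReal_nonneg (Finset.prod_ne_zero_iff.1 ha p hp).symm

variable [∀ p, Fintype (α p)]

/-- Chebyshev's inequality for the information density of a product law. -/
lemma pi_real_infoDensity_deviation_le (P : ∀ p, PMF (α p)) {c : ℝ} (hc : 0 < c) :
    (Measure.pi fun p => (P p).toMeasure).real
        {a | c ≤ |infoDensity P a - ∑ p, entropy (P p)|} ≤
      (∑ p, Var[fun x => -Real.log (P p x).toReal; (P p).toMeasure]) / c ^ 2 := by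
  have hmem : ∀ p, MemLp (fun x => -Real.log (P p x).toReal) 2 (P p).toMeasure :=
    fun p => MemLp.of_discrete
  have hI : infoDensity P = ∑ p, fun a : ∀ p, α p => -Real.log (P p (a p)).toReal := by
    ext a; simp [infoDensity]
  have hcomp : ∀ p, MemLp (fun a : ∀ p, α p => -Real.log (P p (a p)).toReal) 2
      (Measure.pi fun p => (P p).toMeasure) := fun p =>
    (hmem p).comp_measurePreserving (measurePreserving_eval _ p)
  have hmean : ∫ a, infoDensity P a ∂(Measure.pi fun p => (P p).toMeasure) =
      ∑ p, entropy (P p) := by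
    simp only [infoDensity]
    rw [integral_finsetSum _ fun p _ => (hcomp p).integrable (by norm_num)]
    refine Finset.sum_congr rfl fun p _ => ?_
    rw [integral_comp_eval (μ := fun p => (P p).toMeasure)
      (f := fun x => -Real.log (P p x).toReal) (hmem p).1, PMF.integral_eq_sum]
    simp [entropy]
  have hvar := variance_sum_pi hmem
  rw [← hI] at hvar
  have hcheb := meas_ge_le_variance_div_sq
    (hI ▸ memLp_finsetSum' _ fun p _ => hcomp p :
      MemLp (infoDensity P) 2 (Measure.pi fun p => (P p).toMeasure)) hc
  rw [hmean, hvar] at hcheb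
  refine ENNReal.toReal_le_of_le_ofReal ?_ hcheb
  exact div_nonneg (Finset.sum_nonneg fun p _ => variance_nonneg _ _) (sq_nonneg c)

end ProductLaw

/-! ### One-shot source coding bounds -/

section Coding

variable {α 𝒯 : Type*} [Fintype α] [MeasurableSpace α] [MeasurableSingletonClass α]

/-- A finite set of source words can be compressed without loss with at most one index more than
it has elements. -/
lemma exists_compressionScheme {α : Type} [Nonempty α] (f : α → 𝒯) (s : Finset α) :
    ∃ S : CompressionScheme 𝒯, 1 ≤ Nat.card S.M ∧ Nat.card S.M ≤ s.card + 1 ∧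
      ∀ a ∈ s, S.ψ (S.φ (f a)) = f a := by
  classical
  obtain ⟨a₀⟩ := ‹Nonempty α›
  -- The spare word `a₀` keeps the index set nonempty. `f` need not be injective: any preimage in
  -- `s` reconstructs the same object.
  refine ⟨⟨{a // a ∈ insert a₀ s}, inferInstance, fun T =>
    if h : ∃ a ∈ s, f a = T then ⟨h.choose, Finset.mem_insert_of_mem h.choose_spec.1⟩
    else ⟨a₀, Finset.mem_insert_self _ _⟩, fun a => f a⟩, ?_, ?_, fun a ha => ?_⟩
  · simp only [Nat.card_eq_fintype_card, Fintype.card_coe]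
    exact Finset.card_pos.2 ⟨a₀, Finset.mem_insert_self _ _⟩
  · simpa only [Nat.card_eq_fintype_card, Fintype.card_coe] using Finset.card_insert_le a₀ s
  · have h : ∃ b ∈ s, f b = f a := ⟨a, ha, rfl⟩
    simp only [dif_pos h]
    exact h.choose_spec.2

/-- One-shot achievability: the words of information density at most `t` form a set of at most
`exp t` words up to a null set. -/
lemma exists_finset_card_le_exp (ν : Measure α) [IsProbabilityMeasure ν] {I : α → ℝ}
    (hI : ∀ a, ν.real {a} ≠ 0 → ν.real {a} = Real.exp (-I a)) (t : ℝ) :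
    ∃ s : Finset α, (s.card : ℝ) ≤ Real.exp t ∧
      ν.real {a | a ∉ s} ≤ ν.real {a | t ≤ I a} := by
  classical
  refine ⟨Finset.univ.filter fun a => ν.real {a} ≠ 0 ∧ I a ≤ t, ?_, ?_⟩
  · set s : Finset α := Finset.univ.filter fun a => ν.real {a} ≠ 0 ∧ I a ≤ t with hs
    have h1 : (s.card : ℝ) * Real.exp (-t) ≤ 1 := by
      calc (s.card : ℝ) * Real.exp (-t) = ∑ _a ∈ s, Real.exp (-t) := by simp
        _ ≤ ∑ a ∈ s, ν.real {a} := by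
          refine Finset.sum_le_sum fun a ha => ?_
          rw [hs, Finset.mem_filter] at ha
          rw [hI a ha.2.1]
          exact Real.exp_le_exp.2 (neg_le_neg ha.2.2)
        _ = ν.real (s : Set α) := sum_measureReal_singleton s
        _ ≤ 1 := measureReal_le_one
    rwa [Real.exp_neg, ← div_eq_mul_inv, div_le_one (Real.exp_pos t)] at h1
  · have hnull : ν.real {a | ν.real {a} = 0} = 0 := by
      have := sum_measureReal_singleton (μ := ν) (Finset.univ.filter fun a => ν.real {a} = 0)
      rw [Finset.coe_filter_univ] at this
      rw [← this]
      exact Finset.sum_eq_zero fun a ha => (Finset.mem_filter.1 ha).2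
    calc ν.real {a | a ∉ Finset.univ.filter fun a => ν.real {a} ≠ 0 ∧ I a ≤ t}
        ≤ ν.real ({a | ν.real {a} = 0} ∪ {a | t ≤ I a}) := by
          refine measureReal_mono fun a ha => ?_
          by_cases h : ν.real {a} = 0
          · exact Or.inl h
          · have h' : t < I a := by simpa [h] using ha
            exact Or.inr h'.le
      _ ≤ ν.real {a | ν.real {a} = 0} + ν.real {a | t ≤ I a} := measureReal_union_le _ _
      _ = ν.real {a | t ≤ I a} := by rw [hnull, zero_add]

/-- One-shot converse: if the object determines the source word on the event `E`, a scheme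
with `|M|` indices recovers at most `|M| exp (-t)` of the probability of `E` outside the words of
information density at most `t`. -/
lemma real_le_card_mul_exp_add (ν : Measure α) [IsProbabilityMeasure ν] {I : α → ℝ}
    (hI : ∀ a, ν.real {a} ≤ Real.exp (-I a)) {f : α → 𝒯} {E : Set α} (hf : Set.InjOn f E)
    (S : CompressionScheme 𝒯) (t : ℝ) :
    ν.real E ≤ Nat.card S.M * Real.exp (-t) + ν.real {a | S.ψ (S.φ (f a)) ≠ f a} +
      ν.real {a | I a ≤ t} := by
  classical
  have := S.finite_M
  -- Correct decoding and injectivity of `f` on `E` give the words of `B` distinct indices, and each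
  -- has probability at most `exp (-t)`.
  set B : Finset α := {a | a ∈ E ∧ S.ψ (S.φ (f a)) = f a ∧ t ≤ I a} with hB
  have hmem : ∀ a ∈ B, a ∈ E ∧ S.ψ (S.φ (f a)) = f a ∧ t ≤ I a := fun a ha => by
    simpa [hB] using ha
  have hcard : B.card ≤ Nat.card S.M := by
    have := Fintype.ofFinite S.M
    rw [Nat.card_eq_fintype_card]
    refine Finset.card_le_card_of_injOn (fun a => S.φ (f a)) (fun _ _ => Finset.mem_univ _) ?_
    intro a ha b hb hab
    obtain ⟨haE, ha, -⟩ := hmem a ha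
    obtain ⟨hbE, hb, -⟩ := hmem b hb
    exact hf haE hbE (by rw [← ha, ← hb]; exact congrArg S.ψ hab)
  have hBle : ν.real (B : Set α) ≤ Nat.card S.M * Real.exp (-t) := by
    calc ν.real (B : Set α) = ∑ a ∈ B, ν.real {a} := (sum_measureReal_singleton B).symm
      _ ≤ ∑ _a ∈ B, Real.exp (-t) := Finset.sum_le_sum fun a ha =>
          (hI a).trans (Real.exp_le_exp.2 (neg_le_neg (hmem a ha).2.2))
      _ = B.card * Real.exp (-t) := by simp
      _ ≤ Nat.card S.M * Real.exp (-t) := by gcongr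
  calc ν.real E
      ≤ ν.real ((B : Set α) ∪ {a | S.ψ (S.φ (f a)) ≠ f a} ∪ {a | I a ≤ t}) := by
        refine measureReal_mono fun a ha => ?_
        by_cases h1 : S.ψ (S.φ (f a)) = f a
        · rcases le_total t (I a) with h2 | h2
          · exact Or.inl (Or.inl (by simp [hB, ha, h1, h2]))
          · exact Or.inr h2
        · exact Or.inl (Or.inr h1)
    _ ≤ ν.real (B : Set α) + ν.real {a | S.ψ (S.φ (f a)) ≠ f a} + ν.real {a | I a ≤ t} :=
        (measureReal_union_le _ _).trans (by gcongr; exact measureReal_union_le _ _)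
    _ ≤ _ := by gcongr

end Coding

/-! ### Source coding theorem under a weak law -/

section Asymptotics

variable {α : ℕ → Type} {𝒯 : ℕ → Type*} [∀ n, Fintype (α n)] [∀ n, MeasurableSpace (α n)]
  [∀ n, MeasurableSingletonClass (α n)] {ν : ∀ n, Measure (α n)} [∀ n, IsProbabilityMeasure (ν n)]
  {I : ∀ n, α n → ℝ} {H : ℝ}

/-- The direct part of the source coding theorem, for any image of a source whose information
density obeys the weak law. -/
lemma almostLosslesslyAchievable_add (hH : 0 ≤ H)
    (hI : ∀ n a, (ν n).real {a} ≠ 0 → (ν n).real {a} = Real.exp (-I n a))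
    (hlaw : ∀ ε > 0, Tendsto (fun n : ℕ => (ν n).real {a | n * ε ≤ |I n a - n * H|}) atTop (𝓝 0))
    (f : ∀ n, α n → 𝒯 n) {ε : ℝ} (hε : 0 < ε) :
    AlmostLosslesslyAchievable ν f (H + ε) := by
  have key : ∀ n, ∃ S : CompressionScheme (𝒯 n), 1 ≤ Nat.card S.M ∧
      (Nat.card S.M : ℝ) ≤ 2 * Real.exp (n * (H + ε)) ∧
      (ν n).real {a | S.ψ (S.φ (f n a)) ≠ f n a} ≤ (ν n).real {a | n * ε ≤ |I n a - n * H|} := by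
    intro n
    have : Nonempty (α n) := nonempty_of_isProbabilityMeasure (ν n)
    obtain ⟨s, hs, hsν⟩ := exists_finset_card_le_exp (ν n) (hI n) (n * (H + ε))
    obtain ⟨S, hS1, hS, hSf⟩ := exists_compressionScheme (f n) s
    refine ⟨S, hS1, ?_, ?_⟩
    · have h1 : (1 : ℝ) ≤ Real.exp (n * (H + ε)) := Real.one_le_exp (by positivity)
      have h2 : (Nat.card S.M : ℝ) ≤ s.card + 1 := by exact_mod_cast hS
      linarith
    · calc _ ≤ (ν n).real {a | a ∉ s} := measureReal_mono (Set.compl_subset_compl.2 fun a has => hSf a has)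
        _ ≤ _ := hsν
        _ ≤ _ := measureReal_mono fun a ha => by
          simp only [Set.mem_ofPred_eq] at ha ⊢
          exact le_trans (by linarith) (le_abs_self _)
  choose S hS1 hS hSν using key
  refine ⟨S, ?_, ?_⟩
  · have hlim : Tendsto (fun n : ℕ => ((Real.log 2 / n + (H + ε) : ℝ) : EReal)) atTop
        (𝓝 ((H + ε : ℝ) : EReal)) := by
      refine EReal.tendsto_coe.2 ?_
      simpa using (tendsto_const_div_atTop_nhds_zero_nat (Real.log 2)).add_const (H + ε)
    rw [← hlim.limsup_eq]
    refine limsup_le_limsup ?_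
    filter_upwards [eventually_gt_atTop 0] with n hn
    have hn' : (0 : ℝ) < n := by exact_mod_cast hn
    have hcard : (0 : ℝ) < Nat.card (S n).M := by exact_mod_cast hS1 n
    refine EReal.coe_le_coe_iff.2 ?_
    have h := Real.log_le_log hcard (hS n)
    rw [Real.log_mul (by norm_num) (Real.exp_pos _).ne', Real.log_exp] at h
    calc 1 / (n : ℝ) * Real.log (Nat.card (S n).M)
        ≤ 1 / (n : ℝ) * (Real.log 2 + n * (H + ε)) := by gcongr
      _ = Real.log 2 / n + (H + ε) := by field_simp
  · have h := squeeze_zero (fun n => measureReal_nonneg) hSν (hlaw ε hε)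
    exact (ENNReal.tendsto_toReal_iff (fun n => measure_ne_top _ _) ENNReal.zero_ne_top).1
      (by simpa [measureReal_def] using h)

/-- The converse part of the source coding theorem: it suffices that the object determines the
source word on events whose probability is bounded below. -/
lemma le_of_almostLosslesslyAchievable
    (hI : ∀ n a, (ν n).real {a} ≤ Real.exp (-I n a))
    (hlaw : ∀ ε > 0, Tendsto (fun n : ℕ => (ν n).real {a | n * ε ≤ |I n a - n * H|}) atTop (𝓝 0))
    {f : ∀ n, α n → 𝒯 n} {E : ∀ n, Set (α n)} {δ : ℝ} (hδ : 0 < δ)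
    (hE : ∀ᶠ n in atTop, δ ≤ (ν n).real (E n)) (hf : ∀ᶠ n in atTop, Set.InjOn (f n) (E n)) {C : ℝ}
    (hC : AlmostLosslesslyAchievable ν f C) : H ≤ C := by
  obtain ⟨S, hS, herr⟩ := hC
  refine le_of_forall_pos_le_add fun ε hε => ?_
  suffices h : ((H - ε : ℝ) : EReal) ≤ C by
    have := EReal.coe_le_coe_iff.1 h
    linarith
  refine le_trans ?_ hS
  -- Decoding errors and atypical words each eventually take at most `δ / 3`, leaving `δ / 3` for
  -- the counting term.
  have hlim : Tendsto (fun n : ℕ => ((Real.log (δ / 3) / n + (H - ε) : ℝ) : EReal)) atTop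
      (𝓝 ((H - ε : ℝ) : EReal)) := by
    refine EReal.tendsto_coe.2 ?_
    simpa using (tendsto_const_div_atTop_nhds_zero_nat (Real.log (δ / 3))).add_const (H - ε)
  rw [← hlim.limsup_eq]
  refine limsup_le_limsup ?_
  have herr' : Tendsto (fun n => (ν n).real {a | (S n).ψ ((S n).φ (f n a)) ≠ f n a}) atTop
      (𝓝 0) := by
    simpa [measureReal_def] using
      (ENNReal.tendsto_toReal_iff (fun n => measure_ne_top _ _) ENNReal.zero_ne_top).2 herr
  filter_upwards [eventually_gt_atTop 0, hE, hf,
    herr'.eventually_le_const (show 0 < δ / 3 by positivity),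
    (hlaw ε hε).eventually_le_const (show 0 < δ / 3 by positivity)] with n hn hEn hfn h1 h2
  have hn' : (0 : ℝ) < n := by exact_mod_cast hn
  have h3 := real_le_card_mul_exp_add (ν n) (hI n) hfn (S n) (n * (H - ε))
  have h4 : (ν n).real {a | I n a ≤ n * (H - ε)} ≤ (ν n).real {a | n * ε ≤ |I n a - n * H|} :=
    measureReal_mono fun a ha => by
      simp only [Set.mem_ofPred_eq] at ha ⊢
      exact le_trans (by linarith) (neg_le_abs _)
  have h5 : δ / 3 * Real.exp (n * (H - ε)) ≤ Nat.card (S n).M := by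
    have h6 : δ / 3 ≤ Nat.card (S n).M * Real.exp (-(n * (H - ε))) := by linarith
    rwa [Real.exp_neg, ← div_eq_mul_inv, le_div_iff₀ (Real.exp_pos _)] at h6
  refine EReal.coe_le_coe_iff.2 ?_
  have h := Real.log_le_log (by positivity) h5
  rw [Real.log_mul (by positivity) (Real.exp_pos _).ne', Real.log_exp] at h
  calc Real.log (δ / 3) / n + (H - ε) = 1 / (n : ℝ) * (Real.log (δ / 3) + n * (H - ε)) := by
        field_simp
    _ ≤ 1 / (n : ℝ) * Real.log (Nat.card (S n).M) := by gcongr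

end Asymptotics

/-- Achievability depends on the source only through its law. -/
lemma almostLosslesslyAchievable_map {Ω : ℕ → Type*} [∀ n, MeasurableSpace (Ω n)]
    (μ : ∀ n, Measure (Ω n)) {α : ℕ → Type*} [∀ n, MeasurableSpace (α n)]
    [∀ n, DiscreteMeasurableSpace (α n)] {𝒯 : ℕ → Type*} {Y : ∀ n, Ω n → α n}
    (hY : ∀ n, Measurable (Y n)) (f : ∀ n, α n → 𝒯 n) (C : ℝ) :
    AlmostLosslesslyAchievable (fun n => (μ n).map (Y n)) f C ↔
      AlmostLosslesslyAchievable μ (fun n ω => f n (Y n ω)) C := by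
  simp only [AlmostLosslesslyAchievable, Measure.map_apply (hY _) .of_discrete]
  rfl

/-! ### Identifiability of the factors, and their law -/

section Tensor

variable {N R n : ℕ}

/-- If every factor matrix of both decompositions has the same first `R + 1` rows, row `j` having
entry `u i r` in the columns `r ≠ j` and `v i r ≠ u i r` in column `r = j`, then the tensor
determines the factor matrices. -/
lemma cpTensor_injective_of_rows (hN : 2 ≤ N) (hn : R < n) {u v : Fin N → Fin R → ℝ}
    (huv : ∀ i r, v i r ≠ u i r) {A B : Fin N → Matrix (Fin n) (Fin R) ℝ}
    (hA : ∀ i (j : Fin n) r, (j : ℕ) ≤ R → A i j r = if (j : ℕ) = r then v i r else u i r)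
    (hB : ∀ i (j : Fin n) r, (j : ℕ) ≤ R → B i j r = if (j : ℕ) = r then v i r else u i r)
    (hAB : cpTensor A = cpTensor B) : A = B := by
  ext i k s
  have : Nontrivial (Fin N) := Fin.nontrivial_iff_two_le.2 hN
  obtain ⟨i', hi'⟩ := exists_ne i
  -- No column has index `R`, so row `R` is the reference row with entries `u`; row `s` differs from
  -- it in column `s` only.
  let last : Fin n := ⟨R, hn⟩
  let row : Fin n := ⟨s, s.2.trans hn⟩
  have hrow : (row : ℕ) ≤ R := s.2.le
  have hnz : ∀ j, ∃ l : Fin n, (l : ℕ) ≤ R ∧ A j l s ≠ 0 := by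
    intro j
    by_cases h : u j s = 0
    · refine ⟨row, hrow, ?_⟩
      rw [hA j row s hrow, if_pos rfl, ← h]
      exact huv j s
    · refine ⟨last, le_rfl, ?_⟩
      rwa [hA j last s le_rfl, if_neg s.2.ne']
  choose l hl hlA using hnz
  have hAB' : ∀ j (m : Fin n) r, (m : ℕ) ≤ R → B j m r = A j m r := fun j m r h => by
    rw [hA j m r h, hB j m r h]
  -- Mode `i` probes the unknown row `k`, mode `i'` varies over known rows, and the remaining modes
  -- sit at known rows where column `s` is nonzero.
  let κ (m : Fin n) : Fin N → Fin n := Function.update (Function.update l i' m) i k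
  have hsplit : ∀ (D : Fin N → Matrix (Fin n) (Fin R) ℝ) (m : Fin n) (r : Fin R),
      ∏ j, D j (κ m j) r =
        D i k r * (D i' m r * ∏ j ∈ (Finset.univ.erase i).erase i', D j (l j) r) := by
    intro D m r
    rw [← Finset.mul_prod_erase _ _ (Finset.mem_univ i),
      ← Finset.mul_prod_erase _ _ (Finset.mem_erase.2 ⟨hi', Finset.mem_univ i'⟩)]
    congr 1
    · simp [κ]
    congr 1
    · simp [κ, hi']
    refine Finset.prod_congr rfl fun j hj => ?_
    simp only [Finset.mem_erase, Finset.mem_univ, and_true] at hj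
    simp [κ, hj.1, hj.2]
  have hzero : ∀ m : Fin n, (m : ℕ) ≤ R → ∑ r, (A i k r - B i k r) *
      (A i' m r * ∏ j ∈ (Finset.univ.erase i).erase i', A j (l j) r) = 0 := by
    intro m hm
    have h := congrFun hAB (κ m)
    simp only [cpTensor, hsplit] at h
    rw [← sub_eq_zero, ← Finset.sum_sub_distrib] at h
    rw [← h]
    refine Finset.sum_congr rfl fun r _ => ?_
    rw [hAB' i' m r hm, Finset.prod_congr rfl fun j _ => hAB' j (l j) r (hl j)]
    ring
  -- Subtracting the equations for rows `s` and `R` of mode `i'` cancels every column but `s`, whose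
  -- coefficient is nonzero.
  have hdiff := sub_eq_zero.2 ((hzero row hrow).trans (hzero last le_rfl).symm)
  rw [← Finset.sum_sub_distrib, Finset.sum_eq_single s] at hdiff
  · rw [← mul_sub, ← sub_mul, hA i' row s hrow, hA i' last s le_rfl, if_pos rfl,
      if_neg s.2.ne'] at hdiff
    refine sub_eq_zero.1 ((mul_eq_zero.1 hdiff).resolve_right (mul_ne_zero ?_ ?_))
    · exact sub_ne_zero.2 (huv i' s)
    · exact Finset.prod_ne_zero_iff.2 fun j _ => hlA j
  · intro r _ hr
    rw [hA i' row r hrow, hA i' last r le_rfl, if_neg (by simpa [row, Fin.ext_iff] using hr.symm),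
      if_neg r.2.ne', sub_self]
  · simp

/-- The tensor of factor matrices given by their entries in the alphabets. -/
def entriesTensor {𝒳 : Fin N → Finset ℝ} (a : (p : Fin N × Fin n × Fin R) → 𝒳 p.1) :
    tensorAlphabet R 𝒳 n :=
  randomTensor (fun i j r (a : (p : Fin N × Fin n × Fin R) → 𝒳 p.1) => a (i, j, r)) a

lemma entriesTensor_injOn {𝒳 : Fin N → Finset ℝ} (hN : 2 ≤ N) (hn : R < n)
    {u v : ∀ i, Fin R → 𝒳 i} (huv : ∀ i r, v i r ≠ u i r) :
    Set.InjOn (entriesTensor (n := n) (𝒳 := 𝒳))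
      {a | ∀ p, (p.2.1 : ℕ) ≤ R → a p = if (p.2.1 : ℕ) = p.2.2 then v p.1 p.2.2
        else u p.1 p.2.2} := by
  intro a ha b hb hab
  have h := cpTensor_injective_of_rows hN hn (u := fun i r => (u i r : ℝ))
    (v := fun i r => (v i r : ℝ)) (fun i r h => huv i r (Subtype.ext h))
    (fun i j r hj => ?_) (fun i j r hj => ?_) (congrArg Subtype.val hab)
  · funext ⟨i, j, r⟩
    exact Subtype.ext (congrFun (congrFun (congrFun h i) j) r)
  · simp only [Matrix.of_apply, ha (i, j, r) hj]
    split_ifs <;> rfl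
  · simp only [Matrix.of_apply, hb (i, j, r) hj]
    split_ifs <;> rfl

/-- The probability that finitely many rows have prescribed entries does not depend on `n`. -/
lemma pi_real_rows_eq {𝒳 : Fin N → Finset ℝ} (P : ∀ i, Fin R → PMF (𝒳 i)) (hn : R < n)
    (w : ∀ i, ℕ → Fin R → 𝒳 i) :
    (Measure.pi fun p : Fin N × Fin n × Fin R => (P p.1 p.2.2).toMeasure).real
        {a | ∀ p, (p.2.1 : ℕ) ≤ R → a p = w p.1 p.2.1 p.2.2} =
      ∏ i, ∏ j ∈ Finset.range (R + 1), ∏ r, (P i r (w i j r)).toReal := by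
  have hset : {a : (p : Fin N × Fin n × Fin R) → 𝒳 p.1 |
      ∀ p, (p.2.1 : ℕ) ≤ R → a p = w p.1 p.2.1 p.2.2} =
        Set.univ.pi fun p : Fin N × Fin n × Fin R => if (p.2.1 : ℕ) ≤ R then {w p.1 p.2.1 p.2.2} else Set.univ := by
    ext a
    simp only [Set.mem_ofPred_eq, Set.mem_univ_pi]
    refine forall_congr' fun p => ?_
    split_ifs with h <;> simp [h]
  rw [hset, measureReal_def, Measure.pi_pi, ENNReal.toReal_prod, Fintype.prod_prod_type]
  refine Finset.prod_congr rfl fun i _ => ?_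
  rw [Fintype.prod_prod_type]
  have hentry : ∀ (j : Fin n) (r : Fin R), ((P i r).toMeasure
      (if (j : ℕ) ≤ R then {w i j r} else Set.univ)).toReal =
        if (j : ℕ) ≤ R then (P i r (w i j r)).toReal else 1 := by
    intro j r
    split_ifs <;> simp
  simp only [hentry]
  rw [Fin.prod_univ_eq_prod_range
    (fun j => ∏ r, if j ≤ R then (P i r (w i j r)).toReal else 1) n,
    ← Finset.prod_subset (Finset.range_subset_range.2 hn)]
  · refine Finset.prod_congr rfl fun j hj => ?_
    simp [Nat.lt_succ_iff.1 (Finset.mem_range.1 hj)]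
  · intro j _ hj
    simp [show ¬ j ≤ R by simpa [Nat.lt_succ_iff] using hj]

/-- A distribution that is not a point mass charges two distinct values. -/
lemma exists_ne_toReal_pos {β : Type*} (P : PMF β) (hP : ∀ x, P x < 1) :
    ∃ x y, y ≠ x ∧ 0 < (P x).toReal ∧ 0 < (P y).toReal := by
  obtain ⟨x, hx⟩ := P.support_nonempty
  have hpos : ∀ y ∈ P.support, 0 < (P y).toReal := fun y hy =>
    ENNReal.toReal_pos ((P.mem_support_iff y).1 hy) (P.apply_ne_top y)
  by_contra! h
  refine (hP x).ne ((P.apply_eq_one_iff x).2 (Set.eq_singleton_iff_unique_mem.2 ⟨hx, ?_⟩))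
  intro y hy
  by_contra hyx
  exact (h x y hyx (hpos x hx)).not_gt (hpos y hy)

lemma entropy_nonneg {β : Type*} [Fintype β] (P : PMF β) : 0 ≤ entropy P := by
  refine Finset.sum_nonneg fun x _ => ?_
  have h1 : (P x).toReal ≤ 1 :=
    ENNReal.toReal_le_of_le_ofReal zero_le_one (by simpa using P.coe_le_one x)
  have := Real.log_nonpos ENNReal.toReal_nonneg h1
  exact neg_nonneg.2 (mul_nonpos_of_nonneg_of_nonpos ENNReal.toReal_nonneg this)

/-- The weak law of large numbers for the information density of the factor matrices. -/
lemma tendsto_real_infoDensity_deviation {𝒳 : Fin N → Finset ℝ} (P : ∀ i, Fin R → PMF (𝒳 i))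
    {ε : ℝ} (hε : 0 < ε) :
    Tendsto (fun n : ℕ =>
      (Measure.pi fun p : Fin N × Fin n × Fin R => (P p.1 p.2.2).toMeasure).real
        {a | n * ε ≤ |infoDensity (fun p : Fin N × Fin n × Fin R => P p.1 p.2.2) a -
          n * ∑ i, ∑ r, entropy (P i r)|}) atTop (𝓝 0) := by
  have hsum : ∀ (n : ℕ) (g : Fin N → Fin R → ℝ),
      ∑ p : Fin N × Fin n × Fin R, g p.1 p.2.2 = n * ∑ i, ∑ r, g i r := by
    intro n g
    simp [Fintype.sum_prod_type, Finset.mul_sum]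
  set V : ℝ := ∑ i, ∑ r, Var[fun x => -Real.log (P i r x).toReal; (P i r).toMeasure]
    with hV
  refine squeeze_zero' (Eventually.of_forall fun n => measureReal_nonneg) ?_
    (tendsto_const_div_atTop_nhds_zero_nat (V / ε ^ 2))
  filter_upwards [eventually_gt_atTop 0] with n hn
  have hn' : (0 : ℝ) < n := by exact_mod_cast hn
  have h := pi_real_infoDensity_deviation_le
    (fun p : Fin N × Fin n × Fin R => P p.1 p.2.2) (mul_pos hn' hε)
  rw [hsum n fun i r => entropy (P i r), hsum n fun i r =>
    Var[fun x => -Real.log (P i r x).toReal; (P i r).toMeasure], ← hV] at h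
  refine h.trans (le_of_eq ?_)
  field_simp

end Tensor

end TensorCompression

open TensorCompression in
theorem theorem2 {N R : ℕ} (hN : 2 ≤ N) (hR : 2 ≤ R)
    -- the finite alphabets and the column distributions, none of them a point mass
    (𝒳 : Fin N → Finset ℝ)
    (P : (i : Fin N) → Fin R → PMF (𝒳 i))
    (hP : ∀ i r x, P i r x < 1)
    -- for every size `n`, random factor matrices on a probability space
    {Ω : ℕ → Type*} [∀ n, MeasurableSpace (Ω n)]
    (μ : (n : ℕ) → Measure (Ω n)) [∀ n, IsProbabilityMeasure (μ n)]
    (X : (n : ℕ) → (i : Fin N) → Fin n → Fin R → Ω n → 𝒳 i)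
    (hXm : ∀ n i j r, Measurable (X n i j r))
    (hXlaw : ∀ n i j r, (μ n).map (X n i j r) = (P i r).toMeasure)
    (hXindep : ∀ n, iIndepFun
      (fun (p : Fin N × Fin n × Fin R) => X n p.1 p.2.1 p.2.2) (μ n)) :
    TensorCompression.minThreshold μ (fun n => TensorCompression.randomTensor (X n)) =
      ((∑ i, ∑ r, TensorCompression.entropy (P i r) : ℝ) : EReal) := by
  let ν (n : ℕ) : Measure ((p : Fin N × Fin n × Fin R) → 𝒳 p.1) :=
    Measure.pi fun p => (P p.1 p.2.2).toMeasure
  have : ∀ n, IsProbabilityMeasure (ν n) := fun n => inferInstanceAs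
    (IsProbabilityMeasure (Measure.pi fun p : Fin N × Fin n × Fin R => (P p.1 p.2.2).toMeasure))
  let Y (n : ℕ) (ω : Ω n) (p : Fin N × Fin n × Fin R) : 𝒳 p.1 := X n p.1 p.2.1 p.2.2 ω
  have hY : ∀ n, Measurable (Y n) := fun n => measurable_pi_lambda _ fun p => hXm n _ _ _
  have hlawY : (fun n => (μ n).map (Y n)) = ν := by
    funext n
    rw [(iIndepFun_iff_map_fun_eq_pi_map fun p => (hXm n _ _ _).aemeasurable).1 (hXindep n)]
    simp only [hXlaw, ν]
  have hiff : ∀ C : ℝ, AlmostLosslesslyAchievable μ (fun n => randomTensor (X n)) C ↔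
      AlmostLosslesslyAchievable ν (fun _ => entriesTensor) C := by
    intro C
    rw [← hlawY]
    exact (almostLosslesslyAchievable_map μ hY (fun _ => entriesTensor) C).symm
  set H : ℝ := ∑ i, ∑ r, entropy (P i r) with hH
  have hH0 : 0 ≤ H :=
    Finset.sum_nonneg fun i _ => Finset.sum_nonneg fun r _ => entropy_nonneg (P i r)
  have hlaw := fun (ε : ℝ) (hε : ε > 0) => tendsto_real_infoDensity_deviation P hε
  refine le_antisymm ?_ (le_iInf₂ fun C hC => EReal.coe_le_coe_iff.2 ?_)
  -- Achievability is available only with positive slack, so every `z > H` is treated.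
  · refine EReal.le_of_forall_lt_iff_le.1 fun z hz => ?_
    have hz' : H < z := EReal.coe_lt_coe_iff.1 hz
    refine iInf₂_le z ((hiff z).2 ?_)
    have h := almostLosslesslyAchievable_add hH0
      (fun n a ha => pi_real_singleton_eq _ ha) hlaw
      (fun n => entriesTensor (N := N) (R := R) (n := n) (𝒳 := 𝒳)) (sub_pos.2 hz')
    rwa [add_sub_cancel] at h
  · choose u v huv hu hv using fun i r => exists_ne_toReal_pos (P i r) (hP i r)
    let w (i : Fin N) (j : ℕ) (r : Fin R) : 𝒳 i := if j = r then v i r else u i r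
    refine le_of_almostLosslesslyAchievable
      (E := fun n => {a | ∀ p, (p.2.1 : ℕ) ≤ R → a p = w p.1 p.2.1 p.2.2})
      (δ := ∏ i, ∏ j ∈ Finset.range (R + 1), ∏ r, (P i r (w i j r)).toReal)
      (fun n a => pi_real_singleton_le _ a) hlaw ?_ ?_ ?_ ((hiff C).1 hC)
    · refine Finset.prod_pos fun i _ => Finset.prod_pos fun j _ => Finset.prod_pos fun r _ => ?_
      simp only [w]
      split_ifs
      exacts [hv i r, hu i r]
    · filter_upwards [eventually_gt_atTop R] with n hn
      exact (pi_real_rows_eq P hn w).ge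
    · filter_upwards [eventually_gt_atTop R] with n hn
      exact entriesTensor_injOn hN hn huv
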